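/- Let $d\ge 2$ and let $H^2_d$ be the Drury--Arveson module, i.e. the reproducing kernel Hilbert space on the open unit ball $\mathbb B_d\subset\mathbb C^d$ with kernel $K(z,\lambda)=\dfrac{1}{1-\sum_{j=1}^d z_j\overline{\lambda_j}}$, with the multiplication operators $M_{z_1},\dots,M_{z_d}$ by the coordinate functions. A submodule of $H^2_d$ is a closed subspace $\mathcal S$ with $M_{z_i}\mathcal S\subseteq\mathcal S$ for all $i$; it is homogeneous if it contains all homogeneous components (of the power series) of each of its elements. Put $R_{\mathcal S}=(M_{z_1}|_{\mathcal S},\dots,M_{z_d}|_{\mathcal S})$. For a $d$-tuple $T=(T_1,\dots,T_d)$ of commuting operators on a Hilbert space $\mathcal H$ that is contractive ($\sum_i T_iT_i^*\le I$), let $\Psi_T(X)=\sum_{i}T_iXT_i^*$, and for $n\ge1$ let the $n$-th defect index $\Delta_T^n$ be the dimension of the closure of the range of $(I-\Psi_T^n(I))^{1/2}$; write $\Delta_T=\Delta_T^1$. If $\Delta_T<\infty$, the commuting tuple $T$ is called maximal if, for all $n\ge 1$, $\Delta_T^n=c_n\Delta_T$ with $c_n=\sum_{k=0}^{n-1}\binom{k+d-1}{d-1}$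 in case $\dim\mathcal H=\infty$, and $\Delta_T^n=\min(c_n\Delta_T,\dim\mathcal H)$ in case $\dim\mathcal H<\infty$. Theorem. Let $\mathcal S$ be a homogeneous submodule of $H^2_d$ with $\{0\}\ne\mathcal S\ne H^2_d$ and $\Delta_{R_{\mathcal S}}<\infty$. Then $R_{\mathcal S}$ is a commuting contractive tuple and it is not maximal (that is, $\mathcal S$ is not a maximal submodule). -/

import Mathlib

open scoped InnerProductSpace ComplexConjugate

noncomputable section

/-! ### The Drury--Arveson space -/

/-- The Drury--Arveson space `H²_d`, written in its orthonormal basis of normalized monomials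
`e_α(z) = √(|α|! / α!) z ^ α`, `α ∈ ℕ ^ d`: an element is its square-summable family of coordinates.
The instance `DruryArveson.instRKHS` below makes its elements functions on the unit ball, and
`DruryArveson.kernel_apply_one` shows that it is the reproducing kernel Hilbert space
on the unit ball with kernel `K(z, w) = 1 / (1 - ∑ j, z j * conj (w j))`. -/
def DruryArveson (d : ℕ) : Type := lp (fun _ : Fin d → ℕ => ℂ) 2

namespace DruryArveson

variable {d : ℕ}

instance : NormedAddCommGroup (DruryArveson d) :=
  inferInstanceAs (NormedAddCommGroup (lp (fun _ : Fin d → ℕ => ℂ) 2))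

instance : InnerProductSpace ℂ (DruryArveson d) :=
  inferInstanceAs (InnerProductSpace ℂ (lp (fun _ : Fin d → ℕ => ℂ) 2))

instance : CompleteSpace (DruryArveson d) :=
  inferInstanceAs (CompleteSpace (lp (fun _ : Fin d → ℕ => ℂ) 2))

/-- The open unit ball of `ℂ ^ d`. -/
abbrev unitBall (d : ℕ) : Set (EuclideanSpace ℂ (Fin d)) := Metric.ball 0 1

/-- The coordinate of `f` at the normalized monomial `√(|α|! / α!) z ^ α`. -/
def coord (f : DruryArveson d) (α : Fin d → ℕ) : ℂ :=
  (show lp (fun _ : Fin d → ℕ => ℂ) 2 from f) α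

/-- The element with a given square-summable family of coordinates. -/
def ofCoord (c : (Fin d → ℕ) → ℂ) (hc : Summable fun α => ‖c α‖ ^ 2) : DruryArveson d :=
  (⟨c, memℓp_gen (by simpa using hc)⟩ : lp (fun _ : Fin d → ℕ => ℂ) 2)

@[simp] lemma coord_ofCoord (c : (Fin d → ℕ) → ℂ) (hc : Summable fun α => ‖c α‖ ^ 2)
    (α : Fin d → ℕ) : (ofCoord c hc).coord α = c α := rfl

@[ext] lemma ext_coord {f g : DruryArveson d} (h : ∀ α, f.coord α = g.coord α) : f = g :=
  lp.ext (funext h)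

@[simp] lemma coord_add (f g : DruryArveson d) (α : Fin d → ℕ) :
    (f + g).coord α = f.coord α + g.coord α := rfl

@[simp] lemma coord_smul (c : ℂ) (f : DruryArveson d) (α : Fin d → ℕ) :
    (c • f).coord α = c * f.coord α := rfl

@[simp] lemma coord_zero (α : Fin d → ℕ) : (0 : DruryArveson d).coord α = 0 := rfl

lemma hasSum_norm_coord_sq (f : DruryArveson d) :
    HasSum (fun α => ‖f.coord α‖ ^ 2) (‖f‖ ^ 2) := by
  have := lp.hasSum_norm (p := 2) (by norm_num) (show lp (fun _ : Fin d → ℕ => ℂ) 2 from f)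
  simp only [ENNReal.toReal_ofNat, Real.rpow_ofNat] at this
  exact this

lemma hasSum_inner_coord (f g : DruryArveson d) :
    HasSum (fun α => g.coord α * conj (f.coord α)) ⟪f, g⟫_ℂ := by
  have := lp.hasSum_inner (𝕜 := ℂ) (show lp (fun _ : Fin d → ℕ => ℂ) 2 from f)
    (show lp (fun _ : Fin d → ℕ => ℂ) 2 from g)
  simp only [RCLike.inner_apply] at this
  exact this

/-- A sum over multi-indices, grouped by total degree. -/
lemma hasSum_degree {F : (Fin d → ℕ) → ℂ} {a : ℂ} (hF : HasSum F a) :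
    HasSum (fun n : ℕ => ∑ α ∈ Finset.univ.piAntidiag n, F α) a := by
  let e := Equiv.sigmaFiberEquiv (fun α : Fin d → ℕ => ∑ j, α j)
  have h1 : HasSum (F ∘ e) a := e.hasSum_iff.2 hF
  refine h1.sigma fun n => ?_
  have h2 := Finset.hasSum (Finset.univ.piAntidiag n) F
  refine (Equiv.hasSum_iff (Equiv.subtypeEquivRight
    (fun α : Fin d → ℕ => (by simp : (∑ j, α j = n) ↔ α ∈ Finset.univ.piAntidiag n)))).2 h2

/-- `∑ α, (|α|! / α!) x ^ α = 1 / (1 - ∑ j, x j)`. -/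
lemma hasSum_multinomial (x : Fin d → ℂ) (hx : ∑ j, ‖x j‖ < 1) :
    HasSum (fun α : Fin d → ℕ => (Nat.multinomial Finset.univ α : ℂ) * ∏ j, x j ^ α j)
      (1 - ∑ j, x j)⁻¹ := by
  have h0 : 0 ≤ ∑ j, ‖x j‖ := Finset.sum_nonneg fun _ _ => norm_nonneg _
  have hs : Summable
      (fun α : Fin d → ℕ => (Nat.multinomial Finset.univ α : ℂ) * ∏ j, x j ^ α j) := by
    refine Summable.of_norm (summable_of_sum_le (c := (1 - ∑ j, ‖x j‖)⁻¹)
      (fun _ => norm_nonneg _) fun s => ?_)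
    have hsub : s ⊆ (Finset.range (s.sup (fun α => ∑ j, α j) + 1)).biUnion
        fun n => Finset.univ.piAntidiag n := by
      intro α hα
      simp only [Finset.mem_biUnion, Finset.mem_range, Finset.mem_piAntidiag]
      exact ⟨_, Nat.lt_succ_of_le (Finset.le_sup (f := fun α : Fin d → ℕ => ∑ j, α j) hα),
        rfl, by simp⟩
    refine (Finset.sum_le_sum_of_subset_of_nonneg hsub fun _ _ _ => norm_nonneg _).trans ?_
    rw [Finset.sum_biUnion]
    · have : ∀ n, ∑ α ∈ Finset.univ.piAntidiag n,
          ‖(Nat.multinomial Finset.univ α : ℂ) * ∏ j, x j ^ α j‖ = (∑ j, ‖x j‖) ^ n := by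
        intro n
        rw [Finset.sum_pow_eq_sum_piAntidiag]
        simp
      simp only [this]
      rw [← tsum_geometric_of_lt_one h0 hx]
      exact (summable_geometric_of_lt_one h0 hx).sum_le_tsum _ fun _ _ => by positivity
    · intro m _ n _ hmn
      refine Finset.disjoint_left.2 fun α h1 h2 => hmn ?_
      rw [Finset.mem_piAntidiag] at h1 h2
      exact h1.1.symm.trans h2.1
  have h1 := hasSum_degree hs.hasSum
  simp only [← Finset.sum_pow_eq_sum_piAntidiag] at h1
  have h2 := hasSum_geometric_of_norm_lt_one (ξ := ∑ j, x j) ((norm_sum_le _ _).trans_lt hx)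
  rw [h2.unique h1]
  exact hs.hasSum

lemma sum_norm_mul_lt_one (z w : unitBall d) :
    ∑ j, ‖z.1 j * conj (w.1 j)‖ < 1 := by
  have hz : ‖z.1‖ < 1 := mem_ball_zero_iff.1 z.2
  have hw : ‖w.1‖ < 1 := mem_ball_zero_iff.1 w.2
  have h := Real.sum_mul_le_sqrt_mul_sqrt Finset.univ (fun j => ‖z.1 j‖) (fun j => ‖w.1 j‖)
  rw [← EuclideanSpace.norm_eq, ← EuclideanSpace.norm_eq] at h
  simp only [norm_mul, RCLike.norm_conj]
  nlinarith [norm_nonneg z.1, norm_nonneg w.1]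

/-- The value of the normalized monomial `√(|α|! / α!) z ^ α`. -/
def monomialValue (α : Fin d → ℕ) (z : EuclideanSpace ℂ (Fin d)) : ℂ :=
  (√(Nat.multinomial Finset.univ α : ℝ) : ℂ) * ∏ j, z j ^ α j

lemma monomialValue_mul_conj (α : Fin d → ℕ) (z w : EuclideanSpace ℂ (Fin d)) :
    monomialValue α z * conj (monomialValue α w)
      = (Nat.multinomial Finset.univ α : ℂ) * ∏ j, (z j * conj (w j)) ^ α j := by
  have h : (√(Nat.multinomial Finset.univ α : ℝ) : ℂ) * (√(Nat.multinomial Finset.univ α : ℝ) : ℂ)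
      = (Nat.multinomial Finset.univ α : ℂ) := by
    rw [← Complex.ofReal_mul, Real.mul_self_sqrt (Nat.cast_nonneg _)]
    simp
  simp only [monomialValue, map_mul, map_prod, map_pow, Complex.conj_ofReal, mul_pow,
    Finset.prod_mul_distrib]
  rw [← h]
  ring

/-- The kernel function at `z`. -/
def kernelVec (z : unitBall d) : DruryArveson d :=
  ofCoord (fun α => conj (monomialValue α z.1)) (by
    have h := (hasSum_multinomial _ (sum_norm_mul_lt_one z z)).summable.norm
    refine h.congr fun α => ?_
    rw [← monomialValue_mul_conj]
    simp [sq])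

lemma hasSum_inner_kernelVec (f : DruryArveson d) (z : unitBall d) :
    HasSum (fun α => f.coord α * monomialValue α z.1) ⟪kernelVec z, f⟫_ℂ := by
  have h := hasSum_inner_coord (kernelVec z) f
  simpa [kernelVec] using h

/-- A power series that vanishes on the unit ball has zero coefficients. -/
lemma coord_eq_zero_of_forall (f : DruryArveson d)
    (hf : ∀ z : unitBall d, ⟪kernelVec z, f⟫_ℂ = 0) (α : Fin d → ℕ) : f.coord α = 0 := by
  classical
  have hmon : ∀ (β : Fin d → ℕ) (t : ℂ) (z : EuclideanSpace ℂ (Fin d)),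
      monomialValue β (t • z) = t ^ (∑ j, β j) * monomialValue β z := by
    intro β t z
    simp only [monomialValue, PiLp.smul_apply, smul_eq_mul, mul_pow, Finset.prod_mul_distrib,
      Finset.prod_pow_eq_pow_sum]
    ring
  have hcomp : ∀ (n : ℕ) (z : unitBall d),
      ∑ β ∈ Finset.univ.piAntidiag n, f.coord β * monomialValue β z.1 = 0 := by
    intro n z
    set a : ℕ → ℂ := fun n => ∑ β ∈ Finset.univ.piAntidiag n, f.coord β * monomialValue β z.1
      with ha
    have hps : HasFPowerSeriesOnBall (fun _ : ℂ => (0 : ℂ))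
        (FormalMultilinearSeries.ofScalars ℂ a) 0 1 := by
      have hsum : ∀ t : ℂ, ‖t‖ ≤ 1 → HasSum (fun n => t ^ n * a n) 0 := by
        intro t ht
        have hmem : t • z.1 ∈ unitBall d := by
          have hz : ‖z.1‖ < 1 := mem_ball_zero_iff.1 z.2
          simp only [Metric.mem_ball, dist_zero_right, norm_smul]
          nlinarith [norm_nonneg z.1, norm_nonneg t]
        have h := hasSum_degree (hasSum_inner_kernelVec f ⟨t • z.1, hmem⟩)
        rw [hf] at h
        refine h.congr_fun ?_
        intro m
        simp only [ha, Finset.mul_sum, hmon]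
        refine Finset.sum_congr rfl fun β hβ => ?_
        rw [(Finset.mem_piAntidiag.1 hβ).1]
        ring
      refine ⟨?_, one_pos, ?_⟩
      · refine le_of_eq_of_le (by simp) (FormalMultilinearSeries.le_radius_of_tendsto
          (r := 1) _ (l := 0) ?_)
        have := (hsum 1 (by simp)).summable.tendsto_atTop_zero.norm
        simpa using this
      · intro y hy
        have hy' : ‖y‖ ≤ 1 := by
          have h2 : ‖y‖ₑ < 1 := by simpa using hy
          rw [enorm_eq_nnnorm] at h2
          have h3 : ‖y‖₊ < 1 := by exact_mod_cast h2
          exact_mod_cast h3.le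
        simpa [FormalMultilinearSeries.ofScalars_apply_eq, mul_comm] using hsum y hy'
    have h0 := hps.hasFPowerSeriesAt.eq_zero
    have h1 := congrArg (fun p => p.coeff n) h0
    rw [FormalMultilinearSeries.coeff_ofScalars] at h1
    exact h1
  set n := ∑ j, α j with hn
  let P : MvPolynomial (Fin d) ℂ := ∑ β ∈ Finset.univ.piAntidiag n,
    MvPolynomial.monomial (Finsupp.equivFunOnFinite.symm β)
      (f.coord β * (√(Nat.multinomial Finset.univ β : ℝ) : ℂ))
  have hP : ∀ x : Fin d → ℂ, MvPolynomial.eval x P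
      = ∑ β ∈ Finset.univ.piAntidiag n, f.coord β * monomialValue β (WithLp.toLp 2 x) := by
    intro x
    simp only [P, map_sum, MvPolynomial.eval_monomial, monomialValue]
    refine Finset.sum_congr rfl fun β _ => ?_
    rw [Finsupp.prod_fintype _ _ (by simp)]
    simp [mul_assoc]
  have hP0 : P = 0 := by
    refine MvPolynomial.funext fun x => ?_
    rw [hP, map_zero]
    set y : EuclideanSpace ℂ (Fin d) := WithLp.toLp 2 x
    let t : ℂ := ((‖y‖ + 1)⁻¹ : ℝ)
    have ht : t ≠ 0 := by
      have : 0 < ‖y‖ + 1 := by positivity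
      simp only [t, ne_eq, Complex.ofReal_eq_zero]
      positivity
    have hmem : t • y ∈ unitBall d := by
      have h1 : 0 < ‖y‖ + 1 := by positivity
      simp only [Metric.mem_ball, dist_zero_right, norm_smul, t, Complex.norm_real,
        Real.norm_eq_abs, abs_of_pos (inv_pos.2 h1)]
      rw [inv_mul_lt_one₀ h1]
      linarith
    have h := hcomp n ⟨t • y, hmem⟩
    have h2 : t ^ n * ∑ β ∈ Finset.univ.piAntidiag n, f.coord β * monomialValue β y = 0 := by
      rw [← h, Finset.mul_sum]
      refine Finset.sum_congr rfl fun β hβ => ?_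
      simp only [hmon]
      rw [(Finset.mem_piAntidiag.1 hβ).1]
      ring
    exact (mul_eq_zero.1 h2).resolve_left (pow_ne_zero _ ht)
  have hc := congrArg (MvPolynomial.coeff (Finsupp.equivFunOnFinite.symm α)) hP0
  simp only [P, MvPolynomial.coeff_sum, MvPolynomial.coeff_monomial, MvPolynomial.coeff_zero,
    EmbeddingLike.apply_eq_iff_eq] at hc
  rw [Finset.sum_ite_eq' , if_pos (by simp [hn])] at hc
  refine (mul_eq_zero.1 hc).resolve_right ?_
  have : 0 < Nat.multinomial Finset.univ α := Nat.multinomial_pos _ _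
  simp only [ne_eq, Complex.ofReal_eq_zero]
  positivity

/-- Elements of `DruryArveson d` are functions on the unit ball; the value at `z` is
`∑ α, f_α √(|α|! / α!) z ^ α`, see `DruryArveson.hasSum_eval`. -/
instance instRKHS : RKHS ℂ (DruryArveson d) (unitBall d) ℂ where
  coeCLM := ContinuousLinearMap.pi fun z => innerSL ℂ (kernelVec z)
  coeCLM_injective := by
    refine (injective_iff_map_eq_zero _).2 fun f hf => ?_
    ext α
    exact coord_eq_zero_of_forall f (fun z => congrFun hf z) α

lemma eval_eq_inner (f : DruryArveson d) (z : unitBall d) : f z = ⟪kernelVec z, f⟫_ℂ := rfl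

lemma hasSum_eval (f : DruryArveson d) (z : unitBall d) :
    HasSum (fun α => f.coord α * monomialValue α z.1) (f z) :=
  hasSum_inner_kernelVec f z

/-- The reproducing kernel is `K(z, w) = 1 / (1 - ∑ j, z j * conj (w j))`. -/
theorem kernel_apply_one (z w : unitBall d) :
    RKHS.kernel (DruryArveson d) z w 1 = 1 / (1 - ∑ j, z.1 j * conj (w.1 j)) := by
  have h1 : RKHS.kerFun (DruryArveson d) w 1 = kernelVec w := by
    refine ext_inner_right ℂ fun f => ?_
    rw [RKHS.kerFun_inner, eval_eq_inner]
    simp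
  rw [← RKHS.kerFun_apply, h1, one_div]
  refine (hasSum_eval (kernelVec w) z).unique ?_
  refine (hasSum_multinomial _ (sum_norm_mul_lt_one z w)).congr_fun ?_
  intro α
  rw [← monomialValue_mul_conj]
  simp [kernelVec, mul_comm]

/-! ### The `d`-shift -/

lemma hasSum_shift_aux (i : Fin d) {E : Type*} [AddCommMonoid E] [TopologicalSpace E]
    {G : (Fin d → ℕ) → E} {a : E} (hG : ∀ α, α i = 0 → G α = 0)
    (h : HasSum (fun β => G (β + (Pi.single i 1 : Fin d → ℕ))) a) : HasSum G a := by
  refine (Function.Injective.hasSum_iff (add_left_injective (Pi.single i 1 : Fin d → ℕ)) ?_).1 h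
  intro α hα
  refine hG α (by_contra fun h0 => hα ⟨α - Pi.single i 1, ?_⟩)
  funext j
  by_cases hj : j = i
  · subst hj
    simp; omega
  · simp [hj]

/-- The coordinate of `z_i f` at the normalized monomial of multi-index `α`. -/
def coordMulCoord (i : Fin d) (f : DruryArveson d) (α : Fin d → ℕ) : ℂ :=
  (√((α i : ℝ) / (∑ j, α j : ℕ)) : ℂ) * f.coord (α - Pi.single i 1)

lemma coordMulCoord_eq_zero (i : Fin d) (f : DruryArveson d) (α : Fin d → ℕ) (h : α i = 0) :
    coordMulCoord i f α = 0 := by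
  simp [coordMulCoord, h]

lemma coordMulCoord_add (i : Fin d) (f : DruryArveson d) (β : Fin d → ℕ) :
    coordMulCoord i f (β + Pi.single i 1)
      = (√(((β i + 1 : ℕ) : ℝ) / ((∑ j, β j) + 1 : ℕ)) : ℂ) * f.coord β := by
  simp [coordMulCoord, Finset.sum_add_distrib]

lemma norm_coordMulCoord_add_le (i : Fin d) (f : DruryArveson d) (β : Fin d → ℕ) :
    ‖coordMulCoord i f (β + Pi.single i 1)‖ ^ 2 ≤ ‖f.coord β‖ ^ 2 := by
  have h : β i ≤ ∑ j, β j := Finset.single_le_sum (fun _ _ => Nat.zero_le _) (Finset.mem_univ i)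
  have h1 : ((β i + 1 : ℕ) : ℝ) / ((∑ j, β j) + 1 : ℕ) ≤ 1 :=
    div_le_one_of_le₀ (by exact_mod_cast Nat.succ_le_succ h) (Nat.cast_nonneg _)
  have h2 : √(((β i + 1 : ℕ) : ℝ) / ((∑ j, β j) + 1 : ℕ)) ≤ 1 := Real.sqrt_le_one.2 h1
  rw [coordMulCoord_add, norm_mul, Complex.norm_real, Real.norm_eq_abs,
    abs_of_nonneg (Real.sqrt_nonneg _)]
  gcongr
  exact mul_le_of_le_one_left (norm_nonneg _) h2

lemma exists_hasSum_coordMulCoord (i : Fin d) (f : DruryArveson d) :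
    ∃ a ≤ ‖f‖ ^ 2, HasSum (fun α => ‖coordMulCoord i f α‖ ^ 2) a := by
  have hs := hasSum_norm_coord_sq f
  have h1 : Summable fun β => ‖coordMulCoord i f (β + Pi.single i 1)‖ ^ 2 :=
    Summable.of_nonneg_of_le (fun _ => by positivity) (norm_coordMulCoord_add_le i f) hs.summable
  exact ⟨_, hasSum_le (norm_coordMulCoord_add_le i f) h1.hasSum hs,
    hasSum_shift_aux i (fun α h => by simp [coordMulCoord_eq_zero i f α h]) h1.hasSum⟩

/-- Multiplication by the `i`-th coordinate function, `M_{z_i} : H²_d → H²_d`; see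
`DruryArveson.coordMul_eval`. -/
def coordMul (i : Fin d) : DruryArveson d →L[ℂ] DruryArveson d :=
  LinearMap.mkContinuous
    { toFun := fun f => ofCoord (coordMulCoord i f)
        (exists_hasSum_coordMulCoord i f).choose_spec.2.summable
      map_add' := fun f g => by
        ext α
        simp [coordMulCoord, mul_add]
      map_smul' := fun c f => by
        ext α
        simp only [coordMulCoord, coord_ofCoord, coord_smul, RingHom.id_apply]
        ring } 1 fun f => by
    obtain ⟨a, ha, h⟩ := exists_hasSum_coordMulCoord i f
    rw [one_mul, ← sq_le_sq₀ (norm_nonneg _) (norm_nonneg _)]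
    refine le_of_eq_of_le ((hasSum_norm_coord_sq _).unique ?_) ha
    exact h

@[simp] lemma coord_coordMul (i : Fin d) (f : DruryArveson d) (α : Fin d → ℕ) :
    (coordMul i f).coord α
      = (√((α i : ℝ) / (∑ j, α j : ℕ)) : ℂ) * f.coord (α - Pi.single i 1) := rfl

lemma multinomial_add_single (i : Fin d) (β : Fin d → ℕ) :
    (β i + 1) * Nat.multinomial Finset.univ (β + Pi.single i 1)
      = ((∑ j, β j) + 1) * Nat.multinomial Finset.univ β := by
  have h1 := Nat.multinomial_spec Finset.univ (β + Pi.single i 1)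
  have h2 := Nat.multinomial_spec Finset.univ β
  have h3 : ∏ j, ((β + Pi.single i 1 : Fin d → ℕ) j).factorial = (β i + 1) * ∏ j, (β j).factorial := by
    rw [← Finset.mul_prod_erase _ _ (Finset.mem_univ i),
      ← Finset.mul_prod_erase _ (fun j => (β j).factorial) (Finset.mem_univ i)]
    simp only [Pi.add_apply, Pi.single_eq_same, Nat.factorial_succ, mul_assoc]
    congr 2
    refine Finset.prod_congr rfl fun j hj => ?_
    simp [Finset.ne_of_mem_erase hj]
  have h4 : ∑ j, (β + Pi.single i 1 : Fin d → ℕ) j = (∑ j, β j) + 1 := by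
    simp [Finset.sum_add_distrib]
  rw [h3, h4, Nat.factorial_succ, ← h2] at h1
  have hpos : 0 < ∏ j, (β j).factorial := Finset.prod_pos fun j _ => Nat.factorial_pos _
  refine Nat.eq_of_mul_eq_mul_left hpos ?_
  linarith

lemma sqrt_mul_monomialValue (i : Fin d) (β : Fin d → ℕ) (z : EuclideanSpace ℂ (Fin d)) :
    (√(((β i + 1 : ℕ) : ℝ) / ((∑ j, β j) + 1 : ℕ)) : ℂ) * monomialValue (β + Pi.single i 1) z
      = z i * monomialValue β z := by
  have h1 : ((β i + 1 : ℕ) : ℝ) / ((∑ j, β j) + 1 : ℕ)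
      * (Nat.multinomial Finset.univ (β + Pi.single i 1) : ℝ)
      = (Nat.multinomial Finset.univ β : ℝ) := by
    have h := congrArg (Nat.cast (R := ℝ)) (multinomial_add_single i β)
    rw [Nat.cast_mul, Nat.cast_mul] at h
    have : (((∑ j, β j) + 1 : ℕ) : ℝ) ≠ 0 := by positivity
    field_simp
    linarith
  have h2 : ∏ j, z j ^ (β + Pi.single i 1 : Fin d → ℕ) j = z i * ∏ j, z j ^ β j := by
    simp only [Pi.add_apply, pow_add, Finset.prod_mul_distrib]
    rw [mul_comm, Finset.prod_eq_single i (fun j _ hj => by simp [hj]) (by simp)]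
    simp
  rw [monomialValue, monomialValue, h2, ← h1, Real.sqrt_mul (by positivity), Complex.ofReal_mul]
  ring

/-- `coordMul i` is multiplication by the coordinate function `z ↦ z i`. -/
theorem coordMul_eval (i : Fin d) (f : DruryArveson d) (z : unitBall d) :
    coordMul i f z = z.1 i * f z := by
  refine (hasSum_eval (coordMul i f) z).unique (hasSum_shift_aux i (fun α h => ?_) ?_)
  · simp [h]
  · refine ((hasSum_eval f z).mul_left (z.1 i)).congr_fun ?_
    intro β
    have h := coordMulCoord_add i f β
    have h' : (coordMul i f).coord (β + Pi.single i 1) = coordMulCoord i f (β + Pi.single i 1) := rfl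
    rw [h', h, mul_right_comm, sqrt_mul_monomialValue]
    ring

/-! ### Homogeneous components -/

/-- The homogeneous component of degree `n` of `f`: the part of its power series of degree `n`. -/
def homogeneousComponent (n : ℕ) (f : DruryArveson d) : DruryArveson d :=
  ofCoord (fun α => if ∑ j, α j = n then f.coord α else 0)
    (Summable.of_nonneg_of_le (fun _ => by positivity)
      (fun α => by split_ifs <;> simp) (hasSum_norm_coord_sq f).summable)

lemma homogeneousComponent_eval (n : ℕ) (f : DruryArveson d) (z : unitBall d) :
    homogeneousComponent n f z
      = ∑ α ∈ Finset.univ.piAntidiag n, f.coord α * monomialValue α z.1 := by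
  refine (hasSum_eval _ z).unique ?_
  have h := hasSum_sum_of_ne_finset_zero (L := SummationFilter.unconditional _)
    (s := Finset.univ.piAntidiag n) (f := fun α => (homogeneousComponent n f).coord α * monomialValue α z.1) (fun α hα => by
      have : ∑ j, α j ≠ n := by simpa using hα
      simp [homogeneousComponent, this])
  convert h using 1
  refine Finset.sum_congr rfl fun α hα => ?_
  have : ∑ j, α j = n := by simpa using hα
  simp [homogeneousComponent, this]

/-- `f` is the sum of its homogeneous components. -/
lemma hasSum_homogeneousComponent_eval (f : DruryArveson d) (z : unitBall d) :
    HasSum (fun n => homogeneousComponent n f z) (f z) := by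
  simp only [homogeneousComponent_eval]
  exact hasSum_degree (hasSum_eval f z)

end DruryArveson

/-! ### Operator tuples: defect spaces and maximality -/

namespace OperatorTuple

variable {d : ℕ} {H : Type*} [NormedAddCommGroup H] [InnerProductSpace ℂ H] [CompleteSpace H]

/-- The completely positive map `Ψ_T(X) = ∑ i, T_i X T_i^*`. -/
def cpMap (T : Fin d → H →L[ℂ] H) (X : H →L[ℂ] H) : H →L[ℂ] H :=
  ∑ i, T i ∘L X ∘L ContinuousLinearMap.adjoint (T i)

/-- `T_i T_j = T_j T_i` for all `i, j`. -/
def IsCommuting (T : Fin d → H →L[ℂ] H) : Prop := ∀ i j, T i ∘L T j = T j ∘L T i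

/-- `T` is a contractive tuple (row contraction): `∑ i, T_i T_i^* ≤ I`. -/
def IsContractive (T : Fin d → H →L[ℂ] H) : Prop :=
  ∑ i, T i ∘L ContinuousLinearMap.adjoint (T i) ≤ 1

/-- The `n`-th defect operator `D_{T^n} = (I - Ψ_T^n(I))^{1/2}` of a contractive tuple. -/
def defectOperator (T : Fin d → H →L[ℂ] H) (n : ℕ) : H →L[ℂ] H :=
  CFC.sqrt (1 - (cpMap T)^[n] 1)

/-- The `n`-th defect space, the closure of the range of `D_{T^n}`. -/
def defectSpace (T : Fin d → H →L[ℂ] H) (n : ℕ) : Submodule ℂ H :=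
  (LinearMap.range (defectOperator T n).toLinearMap).topologicalClosure

/-- The `n`-th defect index `Δ_T^n`, the dimension of the `n`-th defect space
(`⊤` if it is infinite); `Δ_T = defectIndex T 1`. -/
def defectIndex (T : Fin d → H →L[ℂ] H) (n : ℕ) : ℕ∞ :=
  Cardinal.toENat (Module.rank ℂ (defectSpace T n))

/-- The number `∑_{k=0}^{n-1} C(k + d - 1, d - 1)` (for `d ≥ 1`). -/
def commutingCount (d n : ℕ) : ℕ := ∑ k ∈ Finset.range n, (k + d - 1).choose (d - 1)

/-- Maximality of a commuting contractive `d`-tuple with finite `Δ_T`: the defect indices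
`Δ_T^n`, `n ≥ 1`, have the largest possible values. -/
def IsMaximal (T : Fin d → H →L[ℂ] H) : Prop :=
  (¬ FiniteDimensional ℂ H → ∀ n : ℕ, 1 ≤ n →
    defectIndex T n = commutingCount d n * defectIndex T 1) ∧
  (FiniteDimensional ℂ H → ∀ n : ℕ, 1 ≤ n →
    defectIndex T n = min (commutingCount d n * defectIndex T 1) (Module.finrank ℂ H : ℕ∞))

end OperatorTuple

/-! ### Submodules of the Drury--Arveson module -/

/-- A submodule of `H²_d`: a closed subspace that is invariant under `M_{z_1}, …, M_{z_d}`. -/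
structure DruryArvesonSubmodule (d : ℕ) extends ClosedSubmodule ℂ (DruryArveson d) where
  coordMul_mem' : ∀ i, ∀ f ∈ toClosedSubmodule.toSubmodule,
    DruryArveson.coordMul i f ∈ toClosedSubmodule.toSubmodule

namespace DruryArvesonSubmodule

variable {d : ℕ}

instance (S : DruryArvesonSubmodule d) : CompleteSpace S.toSubmodule :=
  inferInstanceAs (CompleteSpace S.toClosedSubmodule)

/-- The restriction `R_S = (M_{z_1}|_S, …, M_{z_d}|_S)` of the `d`-shift to `S`. -/
def restrictedShift (S : DruryArvesonSubmodule d) (i : Fin d) :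
    S.toSubmodule →L[ℂ] S.toSubmodule :=
  (DruryArveson.coordMul i).restrict (S.coordMul_mem' i)

/-- `S` is homogeneous: it contains the homogeneous components of its elements. -/
def IsHomogeneous (S : DruryArvesonSubmodule d) : Prop :=
  ∀ f ∈ S.toSubmodule, ∀ n, DruryArveson.homogeneousComponent n f ∈ S.toSubmodule

end DruryArvesonSubmodule

end

/-! Write `D = 1 - Ψ(1)`, so that `1 - Ψ²(1) = D + Ψ(D)`. The range of this operator lies in the
image of `W : V × V^d → H`, `W (v, w) = v + ∑ T_i w_i`, where `V` is the range of `D`. Maximality at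
`n = 2` says that the rank of `1 - Ψ²(1)` equals the dimension of the source of `W`, so `W` is
injective: the second-order defect space has no hidden relations.

Let `m` be the least degree occurring in `S`, and `f ≠ 0` a homogeneous element of `S` of degree
`m`. For degree reasons `f` is orthogonal to all `z_i S`, and `z_j f` to all `z_i z_k S`; hence `D f
= f` and `1 - Ψ²(1)` fixes `z_j f`. Injectivity of `W` then forces `‖z_j f‖ = ‖f‖` for every `j`
(`norm_apply_eq_of_defectIndex_two`). But the Drury–Arveson weights give `∑ ‖z_j f‖² = (m + d) / (m
+ 1) ‖f‖²` (`sum_norm_coordMul_sq`). Thus `d (m + 1) = m + d`, and `d ≥ 2` leaves only `m = 0`: `S`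
contains a nonzero constant and is everything (`eq_top_of_const_mem`). -/

namespace OperatorTuple

variable {d : ℕ} {H : Type*} [NormedAddCommGroup H] [InnerProductSpace ℂ H] [CompleteSpace H]

/-! ### Defect operators of a row contraction -/

lemma cpMap_apply (T : Fin d → H →L[ℂ] H) (X : H →L[ℂ] H) (x : H) :
    cpMap T X x = ∑ i, T i (X (ContinuousLinearMap.adjoint (T i) x)) := by
  simp [cpMap]

/-- Orthogonality to the range of `T i` is the same as being killed by its adjoint, which is the
first operator applied in `Ψ_T(1)`. -/
lemma cpMap_one_apply_eq_zero {T : Fin d → H →L[ℂ] H} {x : H}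
    (h : ∀ i y, ⟪x, T i y⟫_ℂ = 0) : cpMap T 1 x = 0 := by
  rw [cpMap_apply]
  refine Finset.sum_eq_zero fun i _ => ?_
  have : ContinuousLinearMap.adjoint (T i) x = 0 := ext_inner_right ℂ fun y => by
    rw [ContinuousLinearMap.adjoint_inner_left, h, inner_zero_left]
  simp [this]

lemma cpMap_cpMap_one_apply_eq_zero {T : Fin d → H →L[ℂ] H} {x : H}
    (h : ∀ i k y, ⟪x, T i (T k y)⟫_ℂ = 0) : cpMap T (cpMap T 1) x = 0 := by
  rw [cpMap_apply]
  refine Finset.sum_eq_zero fun i _ => ?_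
  rw [cpMap_one_apply_eq_zero fun k y => ?_, map_zero]
  rw [ContinuousLinearMap.adjoint_inner_left, h]

lemma isPositive_cpMap (T : Fin d → H →L[ℂ] H) {X : H →L[ℂ] H} (hX : X.IsPositive) :
    (cpMap T X).IsPositive :=
  ContinuousLinearMap.isPositive_sum _ fun i _ => hX.conj_adjoint (T i)

lemma cpMap_sub (T : Fin d → H →L[ℂ] H) (X Y : H →L[ℂ] H) :
    cpMap T (X - Y) = cpMap T X - cpMap T Y := by
  ext x
  simp [cpMap_apply]

lemma IsContractive.one_sub_cpMap_nonneg {T : Fin d → H →L[ℂ] H} (h : IsContractive T) :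
    0 ≤ 1 - cpMap T 1 := sub_nonneg.2 h

lemma one_sub_cpMap_cpMap (T : Fin d → H →L[ℂ] H) :
    1 - cpMap T (cpMap T 1) = (1 - cpMap T 1) + cpMap T (1 - cpMap T 1) := by
  rw [cpMap_sub]; abel

lemma IsContractive.one_sub_cpMap_cpMap_nonneg {T : Fin d → H →L[ℂ] H} (h : IsContractive T) :
    0 ≤ 1 - cpMap T (cpMap T 1) := by
  rw [one_sub_cpMap_cpMap]
  refine add_nonneg h.one_sub_cpMap_nonneg ?_
  rw [ContinuousLinearMap.nonneg_iff_isPositive]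
  exact isPositive_cpMap T
    ((ContinuousLinearMap.nonneg_iff_isPositive _).1 h.one_sub_cpMap_nonneg)

/-- A tuple is contractive if the row operator `(x_i) ↦ ∑ i, T_i x_i` is a contraction. -/
lemma isContractive_of_norm_sum_sq_le (T : Fin d → H →L[ℂ] H)
    (h : ∀ x : Fin d → H, ‖∑ i, T i (x i)‖ ^ 2 ≤ ∑ i, ‖x i‖ ^ 2) : IsContractive T := by
  have hpos : (cpMap T 1).IsPositive := isPositive_cpMap T ContinuousLinearMap.isPositive_one
  change cpMap T 1 ≤ 1
  rw [ContinuousLinearMap.le_def]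
  refine ⟨ContinuousLinearMap.isPositive_one.isSymmetric.sub hpos.isSymmetric, fun x => ?_⟩
  set y : Fin d → H := fun i => ContinuousLinearMap.adjoint (T i) x with hy
  have hx : cpMap T 1 x = ∑ i, T i (y i) := by simp [cpMap_apply, hy]
  have hinner : RCLike.re ⟪∑ i, T i (y i), x⟫_ℂ = ∑ i, ‖y i‖ ^ 2 := by
    rw [sum_inner, map_sum]
    refine Finset.sum_congr rfl fun i _ => ?_
    rw [← ContinuousLinearMap.adjoint_inner_right]
    exact inner_self_eq_norm_sq _
  have h1 := (RCLike.re_le_norm _).trans (norm_inner_le_norm (𝕜 := ℂ) (∑ i, T i (y i)) x)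
  have h2 := h y
  have h3 : RCLike.re ⟪x, x⟫_ℂ = ‖x‖ ^ 2 := inner_self_eq_norm_sq x
  have h4 : ((1 : H →L[ℂ] H) - cpMap T 1) x = x - ∑ i, T i (y i) := by simp [hx]
  change 0 ≤ RCLike.re ⟪((1 : H →L[ℂ] H) - cpMap T 1) x, x⟫_ℂ
  rw [h4, inner_sub_left, map_sub, hinner, h3]
  rw [hinner] at h1
  -- With `s = ∑ T_i y_i` and `a = ∑ ‖y_i‖²`: `2a ≤ 2‖s‖‖x‖ ≤ ‖s‖² + ‖x‖² ≤ a + ‖x‖²`.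
  nlinarith [norm_nonneg (∑ i, T i (y i)), norm_nonneg x, sq_nonneg (‖∑ i, T i (y i)‖ - ‖x‖)]

/-! ### Defect indices as ranks, and the extremal case `n = 2` -/

/-- A symmetric operator is injective on its own range, hence bijective there when that range is
finite-dimensional, so squaring it does not shrink the range. This removes the square root from the
defect operator. -/
lemma range_eq_range_sqrt {A : H →L[ℂ] H} (hA : 0 ≤ A)
    [FiniteDimensional ℂ (LinearMap.range (CFC.sqrt A).toLinearMap)] :
    LinearMap.range A.toLinearMap = LinearMap.range (CFC.sqrt A).toLinearMap := by
  set B := CFC.sqrt A with hB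
  have hBB : ∀ x, A x = B (B x) := fun x => by
    conv_lhs => rw [← CFC.sqrt_mul_sqrt_self A hA]
    rfl
  have hsa : B.toLinearMap.IsSymmetric := (CFC.sqrt_nonneg A).isSelfAdjoint.isSymmetric
  let C : LinearMap.range B.toLinearMap →ₗ[ℂ] LinearMap.range B.toLinearMap :=
    B.toLinearMap.restrict fun x _ => ⟨x, rfl⟩
  have hC : Function.Injective C := by
    refine (injective_iff_map_eq_zero C).2 ?_
    rintro ⟨_, x, rfl⟩ hx
    have hx' : B (B x) = 0 := congrArg Subtype.val hx
    have h0 : ⟪B x, B x⟫_ℂ = 0 := by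
      have := hsa x (B x)
      change ⟪B x, B x⟫_ℂ = ⟪x, B (B x)⟫_ℂ at this
      rw [this, hx', inner_zero_right]
    exact Subtype.ext (inner_self_eq_zero.1 h0)
  refine le_antisymm ?_ ?_
  · rintro _ ⟨x, rfl⟩
    exact ⟨B x, (hBB x).symm⟩
  · intro y hy
    obtain ⟨⟨_, x, rfl⟩, hx⟩ := LinearMap.injective_iff_surjective.1 hC ⟨y, hy⟩
    exact ⟨x, (hBB x).trans (congrArg Subtype.val hx)⟩

/-- A finite defect index is the rank of `I - Ψ_T^n(I)`. -/
lemma finrank_range_of_defectIndex_eq {T : Fin d → H →L[ℂ] H} {n N : ℕ} {A : H →L[ℂ] H}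
    (hA : 1 - (cpMap T)^[n] 1 = A) (hpos : 0 ≤ A) (h : defectIndex T n = N) :
    FiniteDimensional ℂ (LinearMap.range A.toLinearMap) ∧
      Module.finrank ℂ (LinearMap.range A.toLinearMap) = N := by
  have hdef : defectSpace T n
      = (LinearMap.range (CFC.sqrt A).toLinearMap).topologicalClosure := by
    rw [defectSpace, defectOperator, hA]
  have hrank : Module.rank ℂ (defectSpace T n) = N := Cardinal.toENat_eq_natCast.1 h
  rw [hdef] at hrank
  have hfd : FiniteDimensional ℂ
      (LinearMap.range (CFC.sqrt A).toLinearMap).topologicalClosure :=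
    Module.rank_lt_aleph0_iff.1 (hrank ▸ Cardinal.natCast_lt_aleph0)
  have hfd' : FiniteDimensional ℂ (LinearMap.range (CFC.sqrt A).toLinearMap) :=
    Submodule.finiteDimensional_of_le (Submodule.le_topologicalClosure _)
  -- A finite-dimensional range is already closed.
  rw [IsClosed.submodule_topologicalClosure_eq (Submodule.closed_of_finiteDimensional _)] at hrank
  rw [range_eq_range_sqrt hpos]
  exact ⟨hfd', Module.finrank_eq_of_rank_eq hrank⟩

/-- Suppose that the second defect index is as large as possible. If `f` is fixed by
`I - Ψ_T(I)` and `T_j f` by `I - Ψ_T^2(I)`, then `‖T_j f‖ = ‖f‖`. -/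
lemma norm_apply_eq_of_defectIndex_two {T : Fin d → H →L[ℂ] H} (hT : IsContractive T)
    (hfin : defectIndex T 1 < ⊤) (h2 : defectIndex T 2 = (1 + d : ℕ) * defectIndex T 1)
    {f : H} (hf : cpMap T 1 f = 0) {j : Fin d} (hj : cpMap T (cpMap T 1) (T j f) = 0) :
    ‖T j f‖ = ‖f‖ := by
  obtain ⟨N, hN⟩ := ENat.ne_top_iff_exists.1 hfin.ne
  rw [← hN, ← Nat.cast_mul] at h2
  obtain ⟨hfd1, hr1⟩ :=
    finrank_range_of_defectIndex_eq (n := 1) (A := 1 - cpMap T 1) rfl hT.one_sub_cpMap_nonneg hN.symm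
  have hpos2 := hT.one_sub_cpMap_cpMap_nonneg
  rw [one_sub_cpMap_cpMap] at hpos2
  obtain ⟨-, hr2⟩ :=
    finrank_range_of_defectIndex_eq (n := 2) (one_sub_cpMap_cpMap T) hpos2 h2
  have hsymm : (1 - cpMap T 1).IsSymmetric := hT.one_sub_cpMap_nonneg.isSelfAdjoint.isSymmetric
  have hD : (1 - cpMap T 1) f = f := by simp [hf]
  have hE : ((1 - cpMap T 1) + cpMap T (1 - cpMap T 1)) (T j f) = T j f := by
    rw [← one_sub_cpMap_cpMap]; simp [hj]
  generalize 1 - cpMap T 1 = D at *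
  let V := LinearMap.range D.toLinearMap
  have : FiniteDimensional ℂ V := hfd1
  let W : V × (Fin d → V) →ₗ[ℂ] H :=
    V.subtype.coprod (∑ i, (T i).toLinearMap ∘ₗ V.subtype ∘ₗ LinearMap.proj i)
  have hW : ∀ v w, W (v, w) = v + ∑ i, T i (w i) := fun v w => by simp [W]
  -- The canonical preimage under `W` of `(D + Ψ(D)) x`, read off from `D x + ∑ T_i D T_i^* x`.
  let u : H → V × (Fin d → V) := fun x =>
    (⟨D x, x, rfl⟩, fun i => ⟨D (ContinuousLinearMap.adjoint (T i) x), _, rfl⟩)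
  have hWu : ∀ x, W (u x) = (D + cpMap T D) x := fun x => by
    simp [hW, u, cpMap_apply]
  have hle : LinearMap.range (D + cpMap T D).toLinearMap ≤ LinearMap.range W := by
    rintro _ ⟨x, rfl⟩
    exact ⟨u x, hWu x⟩
  -- Dimension count: the source of `W` has dimension `N + d N`, and its range contains a space of
  -- dimension `(1 + d) N`.
  have hinj : Function.Injective W := by
    rw [← LinearMap.ker_eq_bot, ← Submodule.finrank_eq_zero]
    have h3 := Submodule.finrank_mono hle
    have h4 := LinearMap.finrank_range_add_finrank_ker W
    rw [Module.finrank_prod, Module.finrank_pi_fintype, Finset.sum_const, Finset.card_univ,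
      Fintype.card_fin, smul_eq_mul] at h4
    have h5 : Module.finrank ℂ V = N := hr1
    rw [h5] at h4
    rw [hr2] at h3
    linarith
  have hfV : f ∈ V := ⟨f, hD⟩
  -- Both sides are preimages of `T j f` under `W`: the left because `D + Ψ(D)` fixes `T j f`, the
  -- right by inspection.
  have huT : u (T j f) = (0, Pi.single j ⟨f, hfV⟩) := by
    refine hinj ?_
    rw [hWu, hE, hW, Finset.sum_eq_single j (fun i _ hi => by simp [hi]) (by simp)]
    simp
  have h6 : D (ContinuousLinearMap.adjoint (T j) (T j f)) = f := by
    have := congrArg Subtype.val (congrFun (congrArg Prod.snd huT) j)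
    simpa [u] using this
  -- Pair `D T_j^* T_j f = f` with `f`, and move `D` onto `f`, which it fixes.
  have h7 : ⟪T j f, T j f⟫_ℂ = ⟪f, f⟫_ℂ := by
    rw [← ContinuousLinearMap.adjoint_inner_left]
    nth_rw 2 [← hD]
    exact (hsymm _ f).symm.trans (congrArg (fun y => ⟪y, f⟫_ℂ) h6)
  rw [← sq_eq_sq₀ (norm_nonneg _) (norm_nonneg _), ← inner_self_eq_norm_sq (𝕜 := ℂ),
    ← inner_self_eq_norm_sq (𝕜 := ℂ), h7]

end OperatorTuple

/-! ### The `d`-shift in monomial coordinates -/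

namespace DruryArveson

variable {d : ℕ}

lemma coord_coordMul_add_single (i : Fin d) (f : DruryArveson d) (β : Fin d → ℕ) :
    (coordMul i f).coord (β + Pi.single i 1)
      = (√(((β i + 1 : ℕ) : ℝ) / ((∑ j, β j) + 1 : ℕ)) : ℂ) * f.coord β :=
  coordMulCoord_add i f β

lemma coord_coordMul_of_eq_zero {i : Fin d} {α : Fin d → ℕ} (h : α i = 0) (f : DruryArveson d) :
    (coordMul i f).coord α = 0 :=
  coordMulCoord_eq_zero i f α h

lemma coord_coordMul_add_single_eq_zero_iff {i : Fin d} {f : DruryArveson d} {β : Fin d → ℕ} :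
    (coordMul i f).coord (β + Pi.single i 1) = 0 ↔ f.coord β = 0 := by
  have h : (0 : ℝ) < ((β i + 1 : ℕ) : ℝ) / ((∑ j, β j) + 1 : ℕ) := by positivity
  have h' : (√(((β i + 1 : ℕ) : ℝ) / ((∑ j, β j) + 1 : ℕ)) : ℂ) ≠ 0 := by
    exact_mod_cast (Real.sqrt_pos.2 h).ne'
  rw [coord_coordMul_add_single, mul_eq_zero, or_iff_right h']

lemma exists_eq_add_single {i : Fin d} {α : Fin d → ℕ} (h : α i ≠ 0) :
    ∃ β : Fin d → ℕ, β + Pi.single i 1 = α :=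
  ⟨α - Pi.single i 1, tsub_add_cancel_of_le fun j => by
    by_cases hj : j = i
    · subst hj
      simpa using Nat.one_le_iff_ne_zero.2 h
    · simp [hj]⟩

lemma sum_add_single (i : Fin d) (β : Fin d → ℕ) :
    ∑ j, (β + Pi.single i 1 : Fin d → ℕ) j = ∑ j, β j + 1 := by
  simp [Finset.sum_add_distrib]

lemma coord_sum {ι : Type*} (s : Finset ι) (f : ι → DruryArveson d) (α : Fin d → ℕ) :
    (∑ i ∈ s, f i).coord α = ∑ i ∈ s, (f i).coord α := by
  classical
  induction s using Finset.induction_on with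
  | empty => simp
  | insert i s hi ih => simp [Finset.sum_insert hi, ih]

lemma coordMul_comm (i j : Fin d) (f : DruryArveson d) :
    coordMul i (coordMul j f) = coordMul j (coordMul i f) := by
  refine RKHS.coeCLM_injective (𝕜 := ℂ) (X := unitBall d) (V := ℂ) ?_
  funext z
  change coordMul i (coordMul j f) z = coordMul j (coordMul i f) z
  simp only [coordMul_eval]
  ring

/-- The `d`-shift is a row contraction. -/
lemma norm_sum_coordMul_sq_le (x : Fin d → DruryArveson d) :
    ‖∑ i, coordMul i (x i)‖ ^ 2 ≤ ∑ i, ‖x i‖ ^ 2 := by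
  have h1 : ∀ i, HasSum
      (fun α : Fin d → ℕ => if α i = 0 then 0 else ‖(x i).coord (α - Pi.single i 1)‖ ^ 2)
      (‖x i‖ ^ 2) := fun i => by
    refine hasSum_shift_aux i (fun α h => by simp [h]) ?_
    simpa using hasSum_norm_coord_sq (x i)
  refine hasSum_le (fun α => ?_) (hasSum_norm_coord_sq _) (hasSum_sum fun i _ => h1 i)
  rw [coord_sum]
  have h2 : ‖∑ i, (coordMul i (x i)).coord α‖
      ≤ ∑ i, √((α i : ℝ) / (∑ j, α j : ℕ)) *
        (if α i = 0 then 0 else ‖(x i).coord (α - Pi.single i 1)‖) := by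
    refine (norm_sum_le _ _).trans (Finset.sum_le_sum fun i _ => ?_)
    by_cases h : α i = 0
    · simp [h]
    · rw [if_neg h, coord_coordMul, norm_mul, Complex.norm_real, Real.norm_eq_abs,
        abs_of_nonneg (Real.sqrt_nonneg _)]
  -- The squared weights `α_i / |α|` sum to `1`, except at `α = 0`, where division by zero makes the
  -- sum `0`. This is the first factor in Cauchy–Schwarz.
  have h3 : ∑ i, √((α i : ℝ) / (∑ j, α j : ℕ)) ^ 2 ≤ 1 := by
    have : ∀ i, √((α i : ℝ) / (∑ j, α j : ℕ)) ^ 2 = (α i : ℝ) / (∑ j, α j : ℕ) :=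
      fun i => Real.sq_sqrt (by positivity)
    simp only [this, ← Finset.sum_div]
    exact div_le_one_of_le₀ (by push_cast; rfl) (by positivity)
  calc ‖∑ i, (coordMul i (x i)).coord α‖ ^ 2
      ≤ (∑ i, √((α i : ℝ) / (∑ j, α j : ℕ)) *
        (if α i = 0 then 0 else ‖(x i).coord (α - Pi.single i 1)‖)) ^ 2 := by gcongr
    _ ≤ _ := Finset.sum_mul_sq_le_sq_mul_sq _ _ _
    _ ≤ 1 * ∑ i, (if α i = 0 then 0 else ‖(x i).coord (α - Pi.single i 1)‖) ^ 2 := by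
      gcongr
    _ = _ := by
      rw [one_mul]
      refine Finset.sum_congr rfl fun i _ => ?_
      split_ifs <;> simp

/-- `∑ i, ‖z_i f‖² = (m + d) / (m + 1) ‖f‖²` for `f` homogeneous of degree `m`. -/
lemma sum_norm_coordMul_sq {m : ℕ} {f : DruryArveson d}
    (hf : ∀ α, ∑ j, α j ≠ m → f.coord α = 0) :
    ∑ i, ‖coordMul i f‖ ^ 2 = ((m + d : ℝ) / (m + 1)) * ‖f‖ ^ 2 := by
  have h1 : ∀ i, HasSum (fun β : Fin d → ℕ => ((β i + 1 : ℝ) / (m + 1)) * ‖f.coord β‖ ^ 2)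
      (‖coordMul i f‖ ^ 2) := fun i => by
    have hinj := add_left_injective (Pi.single i 1 : Fin d → ℕ)
    refine (((Function.Injective.hasSum_iff hinj ?_).2
      (hasSum_norm_coord_sq (coordMul i f)))).congr_fun ?_
    · intro α hα
      have : α i = 0 := by
        by_contra h0
        exact hα (exists_eq_add_single h0)
      simp [this]
    · intro β
      simp only [Function.comp_apply, coord_coordMul_add_single]
      by_cases hβ : ∑ j, β j = m
      · rw [norm_mul, mul_pow, Complex.norm_real, Real.norm_eq_abs, sq_abs,
          Real.sq_sqrt (by positivity), hβ]
        push_cast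
        rfl
      · simp [hf β hβ]
  refine (hasSum_sum fun i (_ : i ∈ Finset.univ) => h1 i).unique ?_
  refine ((hasSum_norm_coord_sq f).mul_left _).congr_fun fun β => ?_
  by_cases hβ : ∑ j, β j = m
  -- In degree `m`, `∑ i, (β i + 1) = m + d`.
  · rw [← Finset.sum_mul, ← Finset.sum_div, Finset.sum_add_distrib, ← Nat.cast_sum, hβ]
    simp
  · simp [hf β hβ]

lemma coord_coordMul_eq_zero_of_lt {m : ℕ} {g : DruryArveson d}
    (h : ∀ α, ∑ j, α j < m → g.coord α = 0) (i : Fin d) (α : Fin d → ℕ)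
    (hα : ∑ j, α j < m + 1) : (coordMul i g).coord α = 0 := by
  by_cases hi : α i = 0
  · exact coord_coordMul_of_eq_zero hi g
  · obtain ⟨β, rfl⟩ := exists_eq_add_single hi
    rw [sum_add_single] at hα
    rw [coord_coordMul_add_single, h β (by omega), mul_zero]

lemma coord_coordMul_eq_zero_of_ne {m : ℕ} {f : DruryArveson d}
    (h : ∀ α, ∑ j, α j ≠ m → f.coord α = 0) (i : Fin d) (α : Fin d → ℕ)
    (hα : ∑ j, α j ≠ m + 1) : (coordMul i f).coord α = 0 := by
  by_cases hi : α i = 0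
  · exact coord_coordMul_of_eq_zero hi f
  · obtain ⟨β, rfl⟩ := exists_eq_add_single hi
    rw [sum_add_single] at hα
    rw [coord_coordMul_add_single, h β (by omega), mul_zero]

/-- A homogeneous element is orthogonal to the elements of larger order. -/
lemma inner_eq_zero_of_degree_lt {m : ℕ} {f g : DruryArveson d}
    (hf : ∀ α, ∑ j, α j ≠ m → f.coord α = 0)
    (hg : ∀ α, ∑ j, α j < m + 1 → g.coord α = 0) : ⟪f, g⟫_ℂ = 0 := by
  refine (hasSum_inner_coord f g).unique ?_
  convert hasSum_zero with α
  by_cases h : ∑ j, α j = m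
  · simp [hg α (by omega)]
  · simp [hf α h]

end DruryArveson

/-! ### Submodules and their elements of lowest degree -/

namespace DruryArvesonSubmodule

open DruryArveson

variable {d : ℕ} (S : DruryArvesonSubmodule d)

lemma coe_restrictedShift (i : Fin d) (x : S.toSubmodule) :
    (S.restrictedShift i x : DruryArveson d) = coordMul i x := rfl

lemma isCommuting_restrictedShift : OperatorTuple.IsCommuting S.restrictedShift := fun i j => by
  ext1 x
  exact Subtype.ext (coordMul_comm i j x)

/-- A submodule that contains a nonzero constant function is the whole module. -/
lemma eq_top_of_const_mem {f : DruryArveson d} (hfS : f ∈ S.toSubmodule) (hf0 : f.coord 0 ≠ 0)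
    (hf : ∀ α, α ≠ 0 → f.coord α = 0) : S.toSubmodule = ⊤ := by
  -- Multiplying the constant by coordinates reaches a nonzero multiple of every monomial, by
  -- induction on the degree.
  have hmon : ∀ (n : ℕ) (α : Fin d → ℕ), ∑ j, α j = n →
      ∃ h ∈ S.toSubmodule, h.coord α ≠ 0 ∧ ∀ β, β ≠ α → h.coord β = 0 := by
    intro n
    induction n with
    | zero =>
      intro α hα
      have : α = 0 := by
        funext j
        exact (Finset.sum_eq_zero_iff.1 hα) j (Finset.mem_univ j)
      subst this
      exact ⟨f, hfS, hf0, hf⟩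
    | succ n ih =>
      intro α hα
      obtain ⟨i, hi⟩ : ∃ i, α i ≠ 0 := by
        by_contra! h
        simp [h] at hα
      obtain ⟨β, rfl⟩ := exists_eq_add_single hi
      have hβ : ∑ j, β j = n := by
        rw [sum_add_single] at hα
        omega
      obtain ⟨h, hS, h0, hne⟩ := ih β hβ
      refine ⟨coordMul i h, S.coordMul_mem' i h hS,
        coord_coordMul_add_single_eq_zero_iff.not.2 h0, fun γ hγ => ?_⟩
      by_cases hγi : γ i = 0
      · exact coord_coordMul_of_eq_zero hγi h
      · obtain ⟨δ, rfl⟩ := exists_eq_add_single hγi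
        rw [coord_coordMul_add_single, hne δ fun h => hγ (h ▸ rfl), mul_zero]
  -- As `S` is closed, a trivial orthogonal complement suffices; a vector orthogonal to all
  -- monomials has zero coordinates.
  rw [← Submodule.orthogonal_eq_bot_iff, Submodule.eq_bot_iff]
  intro x hx
  ext α
  obtain ⟨h, hS, h0, hne⟩ := hmon _ α rfl
  have h1 := hasSum_inner_coord h x
  rw [hx h hS] at h1
  have h2 := h1.unique (hasSum_single α fun β hβ => by simp [hne β hβ])
  simpa [h0] using h2.symm

end DruryArvesonSubmodule

namespace DruryArvesonSubmodule

open DruryArveson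

variable {d : ℕ} (S : DruryArvesonSubmodule d)

lemma isContractive_restrictedShift : OperatorTuple.IsContractive S.restrictedShift :=
  OperatorTuple.isContractive_of_norm_sum_sq_le _ fun x => by
    have h := norm_sum_coordMul_sq_le fun i => (x i : DruryArveson d)
    have e : ((∑ i, S.restrictedShift i (x i) : S.toSubmodule) : DruryArveson d)
        = ∑ i, coordMul i (x i : DruryArveson d) := by simp [coe_restrictedShift]
    rw [← e] at h
    exact h

/-- A nonzero homogeneous submodule contains a nonzero homogeneous element of degree `m` such that
all elements of the submodule have order at least `m`. -/
lemma exists_mem_of_minimal_degree {S : DruryArvesonSubmodule d} (hS : S.IsHomogeneous)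
    (hne : S.toSubmodule ≠ ⊥) :
    ∃ m : ℕ, (∀ g ∈ S.toSubmodule, ∀ α, ∑ j, α j < m → g.coord α = 0) ∧
      ∃ f ∈ S.toSubmodule, f ≠ 0 ∧ ∀ α, ∑ j, α j ≠ m → f.coord α = 0 := by
  classical
  have hex : ∃ m : ℕ, ∃ g ∈ S.toSubmodule, ∃ α, ∑ j, α j = m ∧ g.coord α ≠ 0 := by
    obtain ⟨g, hg, hg0⟩ := Submodule.exists_mem_ne_zero_of_ne_bot hne
    by_contra! h
    exact hg0 (DruryArveson.ext_coord fun α => h _ g hg α rfl)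
  refine ⟨Nat.find hex, fun g hg α hα => ?_, ?_⟩
  · by_contra h
    exact Nat.find_min hex hα ⟨g, hg, α, rfl, h⟩
  · obtain ⟨g, hg, α, hα, hgα⟩ := Nat.find_spec hex
    refine ⟨_, hS g hg (Nat.find hex), fun h => hgα ?_, fun β hβ => ?_⟩
    · have := congrArg (fun x => coord x α) h
      simpa [homogeneousComponent, hα] using this
    · simp [homogeneousComponent, hβ]

/-- A nonzero submodule with a homogeneous element of lowest degree is infinite-dimensional. -/
lemma not_finiteDimensional (hd : 0 < d) {m : ℕ}
    (hmin : ∀ g ∈ S.toSubmodule, ∀ α, ∑ j, α j < m → g.coord α = 0)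
    {f : DruryArveson d} (hfS : f ∈ S.toSubmodule) (hf0 : f ≠ 0)
    (hf : ∀ α, ∑ j, α j ≠ m → f.coord α = 0) : ¬ FiniteDimensional ℂ S.toSubmodule := by
  intro hfd
  -- Multiplication by one coordinate is injective, so in finite dimension it would be onto `S`.
  -- Then `f` would be a multiple of that coordinate by an element of order at least `m`, hence of
  -- order above `m` and orthogonal to itself.
  have hinj : Function.Injective (S.restrictedShift ⟨0, hd⟩).toLinearMap := by
    refine (injective_iff_map_eq_zero _).2 fun x hx => Subtype.ext (DruryArveson.ext_coord fun β => ?_)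
    have hx' : coordMul ⟨0, hd⟩ (x : DruryArveson d) = 0 := congrArg Subtype.val hx
    refine (coord_coordMul_add_single_eq_zero_iff (i := ⟨0, hd⟩)).1 ?_
    rw [hx', coord_zero]
  obtain ⟨y, hy⟩ := LinearMap.injective_iff_surjective.1 hinj ⟨f, hfS⟩
  have hy' : coordMul ⟨0, hd⟩ (y : DruryArveson d) = f := congrArg Subtype.val hy
  have h := inner_eq_zero_of_degree_lt hf
    (coord_coordMul_eq_zero_of_lt (hmin y y.2) ⟨0, hd⟩)
  rw [hy'] at h
  exact hf0 (inner_self_eq_zero.1 h)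

end DruryArvesonSubmodule

/-! ### The theorem -/

open DruryArveson DruryArvesonSubmodule in
theorem mainTheorem6 (d : ℕ) (hd : 2 ≤ d) (S : DruryArvesonSubmodule d)
    (hhom : S.IsHomogeneous) (hne_bot : S.toSubmodule ≠ ⊥) (hne_top : S.toSubmodule ≠ ⊤)
    (hfin : OperatorTuple.defectIndex S.restrictedShift 1 < ⊤) :
    OperatorTuple.IsCommuting S.restrictedShift ∧
      OperatorTuple.IsContractive S.restrictedShift ∧
      ¬ OperatorTuple.IsMaximal S.restrictedShift := by
  refine ⟨S.isCommuting_restrictedShift, S.isContractive_restrictedShift, fun hmax => ?_⟩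
  obtain ⟨m, hmin, f, hfS, hf0, hf⟩ := exists_mem_of_minimal_degree hhom hne_bot
  have hinf := S.not_finiteDimensional (by omega) hmin hfS hf0 hf
  -- Only `n = 2` of maximality is needed, in its infinite-dimensional form; there `c_2 = 1 + d`.
  have h2 := hmax.1 hinf 2 one_le_two
  have hcount : OperatorTuple.commutingCount d 2 = 1 + d := by
    simp only [OperatorTuple.commutingCount, Finset.sum_range_succ, Finset.sum_range_zero]
    obtain ⟨e, rfl⟩ : ∃ e, d = e + 1 := ⟨d - 1, by omega⟩
    have : 1 + (e + 1) - 1 = e + 1 := by omega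
    simp [this]
  rw [hcount] at h2
  have hnorm : ∀ j, ‖coordMul j f‖ = ‖f‖ := fun j =>
    OperatorTuple.norm_apply_eq_of_defectIndex_two S.isContractive_restrictedShift hfin h2
      (f := ⟨f, hfS⟩) (j := j)
      (OperatorTuple.cpMap_one_apply_eq_zero fun i y =>
        inner_eq_zero_of_degree_lt hf (coord_coordMul_eq_zero_of_lt (hmin y y.2) i))
      (OperatorTuple.cpMap_cpMap_one_apply_eq_zero fun i k y =>
        inner_eq_zero_of_degree_lt (coord_coordMul_eq_zero_of_ne hf j)
          (coord_coordMul_eq_zero_of_lt (coord_coordMul_eq_zero_of_lt (hmin y y.2) k) i))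
  have hsum := sum_norm_coordMul_sq hf
  simp only [hnorm, Finset.sum_const, Finset.card_univ, Fintype.card_fin, nsmul_eq_mul] at hsum
  have h3 := mul_right_cancel₀ (pow_ne_zero 2 (norm_ne_zero_iff.2 hf0)) hsum
  rw [eq_div_iff (by positivity)] at h3
  have h4 : d * (m + 1) = m + d := by exact_mod_cast h3
  -- The equation reduces to `(d - 1) m = 0`.
  have hm : m = 0 := by nlinarith
  subst hm
  have hconst : ∀ α, α ≠ 0 → f.coord α = 0 := fun α hα => hf α fun h => hα <| by
    funext j
    exact (Finset.sum_eq_zero_iff.1 h) j (Finset.mem_univ j)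
  refine hne_top (S.eq_top_of_const_mem hfS (fun h => hf0 ?_) hconst)
  ext α
  by_cases hα : α = 0
  · rw [hα, h, coord_zero]
  · rw [hconst α hα, coord_zero]
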